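/- Let $X=(X(n))_{n\ge 0}$ be a simple random walk on $\mathbb{Z}^2$ perturbed at the origin, that is, a time-homogeneous Markov chain on $\mathbb{Z}^2$ with $X(0)=(0,0)$ a.s. which jumps from every point of $\mathbb{Z}^2\setminus\{(0,0)\}$ to each of its four nearest neighbours with probability $1/4$, and whose jump from $(0,0)$ has an arbitrary fixed distribution on $\mathbb{Z}^2$. Let $|\cdot|$ be the Euclidean norm, and assume that, for a constant $a>0$, $$\mathbb{P}\{|X(1)|>t\}\sim \frac{a}{\log\log t},\qquad t\to\infty .$$ Then $$\liminf_{n\to\infty}\mathbb{P}\Big\{\max_{1\le k\le n}|X(k)|>n\Big\}>0 .$$ Moreover, for each of the four Skorokhod topologies $J_1$, $J_2$, $M_1$, $M_2$ on the space $D([0,\infty),\mathbb{R}^2)$ of càdlàg functions, neither the sequence of distributions of $\big(n^{-1}X(\lfloor nt\rfloor)\big)_{t\ge 0}$, $n\ge 1$, nor the sequence of distributions of $\big(n^{-1/2}X(\lfloor nt\rfloor)\big)_{t\ge 0}$, $n\ge 1$, is tight. -/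

import Mathlib

open Set Filter Topology MeasureTheory Asymptotics
open scoped NNReal ENNReal

/-! ### Locally perturbed random walks on the integer lattice -/

/-- `X` is a (time-homogeneous) Markov chain on the countable state space `S` with transition
probabilities `p x y = P{X(n+1) = y | X(n) = x}`: for every `n` and all states `x 0, …, x (n+1)`,
`P{X 0 = x 0, …, X (n+1) = x (n+1)} = P{X 0 = x 0, …, X n = x n} * p (x n) (x (n+1))`. -/
def IsMarkovChain {Ω S : Type*} [MeasurableSpace Ω] [MeasurableSpace S]
    (p : S → PMF S) (X : ℕ → Ω → S) (P : Measure Ω) : Prop :=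
  (∀ n, Measurable (X n)) ∧
    ∀ (n : ℕ) (x : ℕ → S),
      P {ω | ∀ k ≤ n + 1, X k ω = x k} = P {ω | ∀ k ≤ n, X k ω = x k} * p (x n) (x (n + 1))

/-- Transition probabilities of a standard random walk on `ℤ^d` with step law `ξ`, perturbed on
the finite set `A`: the jump from `x` has law `η x` if `x ∈ A`, and law `ξ` otherwise. -/
noncomputable def perturbedTransition {d : ℕ} (A : Finset (Fin d → ℤ)) (ξ : PMF (Fin d → ℤ))
    (η : (Fin d → ℤ) → PMF (Fin d → ℤ)) (x : Fin d → ℤ) : PMF (Fin d → ℤ) :=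
  if x ∈ A then (η x).map (fun j => x + j) else ξ.map (fun j => x + j)

/-- The step law of the simple random walk on `ℤ²`: each of `±e₁, ±e₂` has probability `1/4`. -/
noncomputable def simpleStep : PMF (Fin 2 → ℤ) :=
  PMF.uniformOfFinset {![1, 0], ![-1, 0], ![0, 1], ![0, -1]} (Finset.insert_nonempty _ _)

/-- The inclusion of the lattice `ℤ^d` in the Euclidean space `ℝ^d`. -/
noncomputable def latticeToEuclidean {d : ℕ} (x : Fin d → ℤ) : EuclideanSpace ℝ (Fin d) :=
  WithLp.toLp 2 (fun i => (x i : ℝ))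

/-! ### The Skorokhod space and the four Skorokhod topologies -/

/-- The Skorokhod space `D([0,∞), E)` of càdlàg functions `[0,∞) → E`. -/
structure SkorokhodSpace (E : Type*) [TopologicalSpace E] where
  /-- the underlying function -/
  toFun : ℝ≥0 → E
  right_continuous : ∀ t, ContinuousWithinAt toFun (Ici t) t
  left_limits : ∀ t, ∃ l, Tendsto toFun (𝓝[<] t) (𝓝 l)

namespace SkorokhodSpace

instance {E : Type*} [TopologicalSpace E] : CoeFun (SkorokhodSpace E) (fun _ => ℝ≥0 → E) :=
  ⟨toFun⟩

/-- The `σ`-algebra generated by the evaluation maps `x ↦ x t`. -/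
instance {E : Type*} [TopologicalSpace E] [MeasurableSpace E] :
    MeasurableSpace (SkorokhodSpace E) :=
  MeasurableSpace.comap toFun MeasurableSpace.pi

section Topologies

variable {E : Type*} [NormedAddCommGroup E] [NormedSpace ℝ E]

/-- The completed graph of `x` on `[0,T]`: the points `(z, t)` with `0 ≤ t ≤ T` and `z` in the
segment from `x(t-)` to `x(t)`, where `x(0-) = x(0)` (which is the value of `Function.leftLim`
at `0`). -/
def completedGraph (x : SkorokhodSpace E) (T : ℝ≥0) : Set (E × ℝ≥0) :=
  {q | q.2 ≤ T ∧ q.1 ∈ segment ℝ (Function.leftLim x q.2) (x q.2)}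

/-- The natural order of the completed graph: by time, and, at a fixed time `t`, by the distance
from `x(t-)`. -/
def GraphLE (x : SkorokhodSpace E) (q q' : E × ℝ≥0) : Prop :=
  q.2 < q'.2 ∨
    (q.2 = q'.2 ∧
      dist (Function.leftLim x q.2) q.1 ≤ dist (Function.leftLim x q'.2) q'.1)

/-- Parametric representations of `x` on `[0,T]`: continuous maps of `[0,1]` onto the completed
graph which are nondecreasing in its natural order. -/
def IsParamRep (x : SkorokhodSpace E) (T : ℝ≥0) (p : unitInterval → E × ℝ≥0) : Prop :=
  Continuous p ∧ range p = completedGraph x T ∧ ∀ s s', s ≤ s' → GraphLE x (p s) (p s')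

/-- `x` and `y` are `ε`-close for the `J₁`-topology of `D([0,T], E)`: up to `ε`, they differ by
an increasing homeomorphism of `[0,T]` that is `ε`-close to the identity. -/
def NearJ1 (T : ℝ≥0) (ε : ℝ) (x y : SkorokhodSpace E) : Prop :=
  ∃ l : Icc (0 : ℝ≥0) T ≃o Icc (0 : ℝ≥0) T,
    ∀ t, dist (l t) t < ε ∧ dist (x (l t)) (y t) < ε

/-- `x` and `y` are `ε`-close for the `J₂`-topology of `D([0,T], E)`: as for `J₁`, with arbitrary
(possibly discontinuous) bijections of `[0,T]` as time changes. -/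
def NearJ2 (T : ℝ≥0) (ε : ℝ) (x y : SkorokhodSpace E) : Prop :=
  ∃ l : Icc (0 : ℝ≥0) T ≃ Icc (0 : ℝ≥0) T,
    ∀ t, dist (l t) t < ε ∧ dist (x (l t)) (y t) < ε

/-- `x` and `y` are `ε`-close for the `M₁`-topology of `D([0,T], E)`: they have uniformly
`ε`-close parametric representations. -/
def NearM1 (T : ℝ≥0) (ε : ℝ) (x y : SkorokhodSpace E) : Prop :=
  ∃ p q : unitInterval → E × ℝ≥0,
    IsParamRep x T p ∧ IsParamRep y T q ∧ ∀ s, dist (p s) (q s) < ε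

/-- `x` and `y` are `ε`-close for the `M₂`-topology of `D([0,T], E)`: their completed graphs have
Hausdorff distance less than `ε`. -/
def NearM2 (T : ℝ≥0) (ε : ℝ) (x y : SkorokhodSpace E) : Prop :=
  Metric.hausdorffEDist (completedGraph x T) (completedGraph y T) < ENNReal.ofReal ε

/-- The topology on `D([0,∞), E)` obtained from the topologies of the spaces `D([0,T], E)`: the
neighbourhoods of `x` are generated by the sets `{y | y is ε-close to x on [0,T]}`, where `ε > 0`
and `T > 0` is a continuity point of `x`. Thus `y` tends to `x` if and only if the
restriction of `y` to `[0,T]` tends to that of `x` for each continuity point `T > 0` of `x`. -/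
abbrev topologyOfNear (near : ℝ≥0 → ℝ → SkorokhodSpace E → SkorokhodSpace E → Prop) :
    TopologicalSpace (SkorokhodSpace E) :=
  TopologicalSpace.mkOfNhds fun x =>
    ⨅ (T : ℝ≥0) (_ : 0 < T ∧ ContinuousAt x T) (ε : ℝ) (_ : 0 < ε), 𝓟 {y | near T ε y x}

variable (E)

/-- The `J₁`-topology on `D([0,∞), E)`. -/
abbrev topologyJ1 : TopologicalSpace (SkorokhodSpace E) := topologyOfNear NearJ1

/-- The `J₂`-topology on `D([0,∞), E)`. -/
abbrev topologyJ2 : TopologicalSpace (SkorokhodSpace E) := topologyOfNear NearJ2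

/-- The `M₁`-topology on `D([0,∞), E)`. -/
abbrev topologyM1 : TopologicalSpace (SkorokhodSpace E) := topologyOfNear NearM1

/-- The `M₂`-topology on `D([0,∞), E)`. -/
abbrev topologyM2 : TopologicalSpace (SkorokhodSpace E) := topologyOfNear NearM2

end Topologies

/-- The path `t ↦ f(⌊n t⌋) / c` for a sequence `f` in `E`. -/
noncomputable def scaledPath {E : Type*} [NormedAddCommGroup E] [NormedSpace ℝ E]
    (f : ℕ → E) (n : ℕ) (c : ℝ) : SkorokhodSpace E where
  toFun t := c⁻¹ • f ⌊(n : ℝ≥0) * t⌋₊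
  right_continuous t := by
    have hcont : Continuous fun s : ℝ≥0 => (n : ℝ≥0) * s := by fun_prop
    have h1 : ∀ᶠ s in 𝓝 t, (n : ℝ≥0) * s < ⌊(n : ℝ≥0) * t⌋₊ + 1 :=
      hcont.continuousAt.eventually_lt_const (Nat.lt_floor_add_one _)
    have h2 : (fun s : ℝ≥0 => c⁻¹ • f ⌊(n : ℝ≥0) * s⌋₊) =ᶠ[𝓝[Ici t] t]
        fun _ => c⁻¹ • f ⌊(n : ℝ≥0) * t⌋₊ := by
      filter_upwards [mem_nhdsWithin_of_mem_nhds h1, self_mem_nhdsWithin] with s hs hts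
      have hle : (n : ℝ≥0) * t ≤ n * s := by gcongr; exact hts
      have : ⌊(n : ℝ≥0) * s⌋₊ = ⌊(n : ℝ≥0) * t⌋₊ := by
        rw [Nat.floor_eq_iff zero_le]
        exact ⟨(Nat.floor_le zero_le).trans hle, hs⟩
      rw [this]
    exact tendsto_const_nhds.congr' h2.symm
  left_limits t := by
    rcases eq_or_ne ((n : ℝ≥0) * t) 0 with h0 | h0
    · refine ⟨c⁻¹ • f 0, tendsto_const_nhds.congr' ?_⟩
      filter_upwards [self_mem_nhdsWithin] with s hs
      have hs' : (n : ℝ≥0) * s = 0 := by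
        refine le_antisymm ?_ zero_le
        rw [← h0]; gcongr; exact le_of_lt hs
      rw [hs', Nat.floor_zero]
    · refine ⟨c⁻¹ • f (⌈(n : ℝ≥0) * t⌉₊ - 1), tendsto_const_nhds.congr' ?_⟩
      have hn : (0 : ℝ≥0) < n := by
        rcases Nat.eq_zero_or_pos n with h | h
        · simp [h] at h0
        · exact_mod_cast h
      have hpos : 0 < ⌈(n : ℝ≥0) * t⌉₊ := Nat.ceil_pos.2 (pos_iff_ne_zero.2 h0)
      have hcont : Continuous fun s : ℝ≥0 => (n : ℝ≥0) * s := by fun_prop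
      have hlt : ((⌈(n : ℝ≥0) * t⌉₊ - 1 : ℕ) : ℝ≥0) < n * t := by
        rw [← Nat.lt_ceil]; omega
      have h1 : ∀ᶠ s in 𝓝 t, ((⌈(n : ℝ≥0) * t⌉₊ - 1 : ℕ) : ℝ≥0) < n * s :=
        hcont.continuousAt.eventually_const_lt hlt
      filter_upwards [mem_nhdsWithin_of_mem_nhds h1, self_mem_nhdsWithin] with s hs hst
      have hle : (n : ℝ≥0) * s < n * t := mul_lt_mul_of_pos_left hst hn
      have : ⌊(n : ℝ≥0) * s⌋₊ = ⌈(n : ℝ≥0) * t⌉₊ - 1 := by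
        rw [Nat.floor_eq_iff zero_le]
        refine ⟨hs.le, hle.trans_le ((Nat.le_ceil _).trans ?_)⟩
        have : ⌈(n : ℝ≥0) * t⌉₊ ≤ (⌈(n : ℝ≥0) * t⌉₊ - 1) + 1 := by omega
        exact_mod_cast this
      rw [this]

end SkorokhodSpace

/-! The tail of the jump from the origin is so heavy that `exp (√(log n))` and `n ^ 2` are exceeded
with probabilities of the same order `1 / log log n`. Call a jump short if its norm is at most `exp
(√(log n))` and huge if its norm exceeds `n ^ 2`. After a short jump the planar walk is back at the
origin within about `√n` steps, except with probability `O(1 / √(log n))`, which is negligible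
against `1 / log log n`. So a small multiple of `log log n` excursions fits into time `n`. With
probability bounded below, one of their initial jumps is huge and all earlier ones are short and
followed by a quick return.

The quick return is `one_sub_le_srwHit`, proved with an explicit logarithmic superharmonic function
and the martingale `|S_k|² - k`. The excursions are chained in `le_hitProb_origin_iterate`, and the
parameters are chosen in `eventually_le_measure_exists_sq_lt_norm`.

Since the level reached is `n ^ 2`, the maxima escape under both scalings. Tightness then fails
because, for each of the four topologies, a compact set is uniformly bounded on `[0,1]`
(`exists_norm_lt_of_isCompact`). All that is used of the topologies is the common property
`NearGraph`. -/

/-! ### Hitting probabilities of Markov chains -/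

/-- The probability that a Markov chain with transition probabilities `p`, started at `x`, visits
`B` at one of the times `1, …, j`. -/
noncomputable def hitProb {S : Type*} (p : S → PMF S) (B : Set S) : ℕ → S → ℝ≥0∞
  | 0, _ => 0
  | j + 1, x => ∑' y, p x y * (B.indicator 1 y + Bᶜ.indicator (hitProb p B j) y)

/-- First-step analysis carried out on cylinder events, since the Markov property is given only for
these. The events for different next states are disjoint, so their probabilities add up to at most
that of the union. -/
theorem hitProb_le_measure {Ω S : Type*} [MeasurableSpace Ω] [MeasurableSpace S] [Countable S]
    [MeasurableSingletonClass S] {p : S → PMF S} {X : ℕ → Ω → S} {P : Measure Ω}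
    (hX : IsMarkovChain p X P) {B : Set S} (hB : MeasurableSet B) (j k : ℕ) (x : ℕ → S) :
    P {ω | ∀ i ≤ k, X i ω = x i} * hitProb p B j (x k) ≤
      P {ω | (∀ i ≤ k, X i ω = x i) ∧ ∃ i ∈ Finset.Icc (k + 1) (k + j), X i ω ∈ B} := by
  have hmeas : ∀ i y, MeasurableSet {ω | X i ω = y} := fun i y =>
    hX.1 i (measurableSet_singleton y)
  have hcyl : ∀ (k : ℕ) (x : ℕ → S), MeasurableSet {ω | ∀ i ≤ k, X i ω = x i} := by
    intro k x
    simp only [ofPred_forall]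
    exact MeasurableSet.iInter fun i => MeasurableSet.iInter fun _ => hmeas i _
  have hevent : ∀ (s : Finset ℕ), MeasurableSet {ω | ∃ i ∈ s, X i ω ∈ B} := by
    intro s
    have : {ω | ∃ i ∈ s, X i ω ∈ B} = ⋃ i ∈ s, X i ⁻¹' B := by ext; simp
    rw [this]
    exact s.measurableSet_biUnion fun i _ => hX.1 i hB
  induction j generalizing k x with
  | zero => simp [hitProb]
  | succ j ih =>
    set E := {ω | (∀ i ≤ k, X i ω = x i) ∧ ∃ i ∈ Finset.Icc (k + 1) (k + (j + 1)), X i ω ∈ B}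
    have hE : MeasurableSet E := (hcyl k x).inter (hevent _)
    have hstep : ∀ y, P {ω | ∀ i ≤ k, X i ω = x i} * (p (x k) y *
        (B.indicator 1 y + Bᶜ.indicator (hitProb p B j) y)) ≤ P (E ∩ {ω | X (k + 1) ω = y}) := by
      intro y
      -- The prescribed trajectory is prolonged by the next state `y`, so that the induction
      -- hypothesis applies at time `k + 1`.
      set x' := Function.update x (k + 1) y
      have hx' : ∀ i ≤ k, x' i = x i := fun i hi => Function.update_of_ne (by omega) _ _
      have hk' : x' (k + 1) = y := Function.update_self _ _ _
      have h0 : P {ω | ∀ i ≤ k + 1, X i ω = x' i} =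
          P {ω | ∀ i ≤ k, X i ω = x i} * p (x k) y := by
        rw [hX.2 k x', hk', hx' k le_rfl]
        congr 3
        ext ω
        exact forall₂_congr fun i hi => by rw [hx' i hi]
      have hsub : ∀ ω, (∀ i ≤ k + 1, X i ω = x' i) →
          (∀ i ≤ k, X i ω = x i) ∧ X (k + 1) ω = y := fun ω hω =>
        ⟨fun i hi => (hω i (by omega)).trans (hx' i hi), (hω _ le_rfl).trans hk'⟩
      rw [← mul_assoc, ← h0]
      by_cases hy : y ∈ B
      · simp only [hy, indicator_of_mem, Pi.one_apply, mem_compl_iff, not_true_eq_false,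
          not_false_eq_true, indicator_of_notMem, add_zero, mul_one]
        refine measure_mono fun ω hω => ?_
        obtain ⟨h1, h2⟩ := hsub ω hω
        exact ⟨⟨h1, k + 1, by simp, h2 ▸ hy⟩, h2⟩
      · simp only [hy, indicator_of_mem, mem_compl_iff,
          not_false_eq_true, indicator_of_notMem, zero_add]
        have := ih (k + 1) x'
        rw [hk'] at this
        refine this.trans (measure_mono fun ω hω => ?_)
        obtain ⟨h1, h2⟩ := hsub ω hω.1
        obtain ⟨i, hi, hiB⟩ := hω.2
        rw [Finset.mem_Icc] at hi
        exact ⟨⟨h1, i, by rw [Finset.mem_Icc]; omega, hiB⟩, h2⟩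
    rw [hitProb, ← ENNReal.tsum_mul_left]
    refine (ENNReal.tsum_le_tsum hstep).trans ?_
    refine (tsum_meas_le_meas_iUnion_of_disjoint P (fun y => hE.inter (hmeas _ y)) ?_).trans
      (measure_mono (iUnion_subset fun y => inter_subset_left))
    intro y z hyz
    exact disjoint_left.2 fun ω h1 h2 => hyz (h1.2.symm.trans h2.2)

theorem hitProb_le_one {S : Type*} (p : S → PMF S) (B : Set S) (j : ℕ) (x : S) :
    hitProb p B j x ≤ 1 := by
  induction j generalizing x with
  | zero => simp [hitProb]
  | succ j ih =>
    rw [hitProb, ← (p x).tsum_coe]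
    refine ENNReal.tsum_le_tsum fun y => mul_le_of_le_one_right' ?_
    by_cases hy : y ∈ B <;> simp [hy, ih]

theorem hitProb_mono {S : Type*} (p : S → PMF S) (B : Set S) (x : S) :
    Monotone fun j => hitProb p B j x := by
  refine monotone_nat_of_le_succ fun j => ?_
  induction j generalizing x with
  | zero => simp [hitProb]
  | succ j ih =>
    rw [hitProb, hitProb]
    gcongr with y
    simp [ih]

/-! ### Returns of the simple random walk on `ℤ²` to the origin -/

/-- The average of `F` over the four nearest neighbours of `x`. -/
noncomputable def nbrAvg (F : (Fin 2 → ℤ) → ℝ) (x : Fin 2 → ℤ) : ℝ :=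
  (F (x + ![1, 0]) + F (x + ![-1, 0]) + F (x + ![0, 1]) + F (x + ![0, -1])) / 4

theorem nbrAvg_nonneg {F : (Fin 2 → ℤ) → ℝ} (hF : ∀ x, 0 ≤ F x) (x : Fin 2 → ℤ) :
    0 ≤ nbrAvg F x := by
  have := hF (x + ![1, 0]); have := hF (x + ![-1, 0])
  have := hF (x + ![0, 1]); have := hF (x + ![0, -1])
  unfold nbrAvg; positivity

theorem PMF.map_apply_of_injective {α β : Type*} (p : PMF α) {f : α → β}
    (hf : Function.Injective f) (a : α) : p.map f (f a) = p a := by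
  classical
  rw [PMF.map_apply, tsum_eq_single a]
  · simp
  · intro b hb
    simp [hf.ne hb.symm]

theorem perturbedTransition_zero (η : (Fin 2 → ℤ) → PMF (Fin 2 → ℤ)) :
    perturbedTransition {0} simpleStep η 0 = η 0 := by
  rw [perturbedTransition, if_pos (by simp)]
  simp only [zero_add]
  exact PMF.map_id (η 0)

theorem simpleStep_apply {e : Fin 2 → ℤ}
    (he : e ∈ ({![1, 0], ![-1, 0], ![0, 1], ![0, -1]} : Finset (Fin 2 → ℤ))) :
    simpleStep e = 4⁻¹ := by
  have hcard : ({![1, 0], ![-1, 0], ![0, 1], ![0, -1]} : Finset (Fin 2 → ℤ)).card = 4 := by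
    decide
  rw [simpleStep, PMF.uniformOfFinset_apply_of_mem _ he, hcard]
  norm_num

theorem ofReal_nbrAvg_le_tsum (η : (Fin 2 → ℤ) → PMF (Fin 2 → ℤ)) {x : Fin 2 → ℤ} (hx : x ≠ 0)
    {F : (Fin 2 → ℤ) → ℝ} (hF : ∀ x, 0 ≤ F x) :
    ENNReal.ofReal (nbrAvg F x) ≤
      ∑' y, perturbedTransition {0} simpleStep η x y * ENNReal.ofReal (F y) := by
  set s : Finset (Fin 2 → ℤ) := {![1, 0], ![-1, 0], ![0, 1], ![0, -1]} with hs
  have hinj : Function.Injective fun e : Fin 2 → ℤ => x + e := add_right_injective x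
  have hp : ∀ e ∈ s, perturbedTransition {0} simpleStep η x (x + e) = 4⁻¹ := by
    intro e he
    rw [perturbedTransition, if_neg (by simpa using hx)]
    rw [PMF.map_apply_of_injective _ hinj e, simpleStep_apply he]
  refine le_trans ?_ (ENNReal.sum_le_tsum (s.map ⟨_, hinj⟩))
  rw [Finset.sum_map]
  have h4 : (4 : ℝ≥0∞)⁻¹ = ENNReal.ofReal 4⁻¹ := by
    rw [ENNReal.ofReal_inv_of_pos (by norm_num)]; simp
  have : ∀ e ∈ s, perturbedTransition {0} simpleStep η x ((⟨_, hinj⟩ : (Fin 2 → ℤ) ↪ _) e) *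
      ENNReal.ofReal (F ((⟨_, hinj⟩ : (Fin 2 → ℤ) ↪ _) e)) =
      ENNReal.ofReal (4⁻¹ * F (x + e)) := by
    intro e he
    rw [ENNReal.ofReal_mul (by norm_num), ← h4, ← hp e he]
    rfl
  rw [Finset.sum_congr rfl this, ← ENNReal.ofReal_sum_of_nonneg]
  · refine ENNReal.ofReal_le_ofReal (le_of_eq ?_)
    rw [hs, Finset.sum_insert (by decide), Finset.sum_insert (by decide),
      Finset.sum_insert (by decide), Finset.sum_singleton, nbrAvg]
    ring
  · intro e _
    have := hF (x + e)
    positivity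

open Classical in
/-- The probability that the simple random walk on `ℤ²` started at `x` visits the origin at one of
the times `0, …, k`. -/
noncomputable def srwHit : ℕ → (Fin 2 → ℤ) → ℝ
  | 0, x => if x = 0 then 1 else 0
  | k + 1, x => if x = 0 then 1 else nbrAvg (srwHit k) x

@[simp] theorem srwHit_zero_right (k : ℕ) : srwHit k 0 = 1 := by
  cases k <;> simp [srwHit]

theorem srwHit_succ (k : ℕ) {x : Fin 2 → ℤ} (hx : x ≠ 0) :
    srwHit (k + 1) x = nbrAvg (srwHit k) x := by
  simp [srwHit, hx]

theorem srwHit_nonneg (k : ℕ) (x : Fin 2 → ℤ) : 0 ≤ srwHit k x := by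
  induction k generalizing x with
  | zero => rw [srwHit]; split_ifs <;> norm_num
  | succ k ih =>
    rw [srwHit]
    split_ifs
    · norm_num
    · exact nbrAvg_nonneg ih x

/-- The perturbed walk moves like the simple one until it reaches the origin, and restarts there. A
visit to `B` on the way only helps, because hitting probabilities are at most `1`. -/
theorem srwHit_mul_hitProb_le (η : (Fin 2 → ℤ) → PMF (Fin 2 → ℤ)) (B : Set (Fin 2 → ℤ))
    (j k : ℕ) (x : Fin 2 → ℤ) :
    ENNReal.ofReal (srwHit k x) * hitProb (perturbedTransition {0} simpleStep η) B j 0 ≤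
      hitProb (perturbedTransition {0} simpleStep η) B (j + k) x := by
  set p := perturbedTransition {0} simpleStep η
  induction k generalizing x with
  | zero => by_cases hx : x = 0 <;> simp [srwHit, hx]
  | succ k ih =>
    rcases eq_or_ne x 0 with rfl | hx
    · simpa using hitProb_mono p B 0 (by omega : j ≤ j + (k + 1))
    · rw [srwHit_succ k hx, ← add_assoc, hitProb]
      refine (mul_le_mul_left (ofReal_nbrAvg_le_tsum η hx (srwHit_nonneg k)) _).trans ?_
      rw [← ENNReal.tsum_mul_right]
      refine ENNReal.tsum_le_tsum fun y => ?_
      rw [mul_assoc]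
      refine mul_le_mul_right ((ih y).trans ?_) _
      by_cases hy : y ∈ B <;> simp [hy, hitProb_le_one]

/-- The squared Euclidean norm on `ℤ²`. -/
def normSqInt (x : Fin 2 → ℤ) : ℝ := (x 0 : ℝ) ^ 2 + (x 1 : ℝ) ^ 2

theorem one_le_normSqInt {x : Fin 2 → ℤ} (hx : x ≠ 0) : 1 ≤ normSqInt x := by
  have : (1 : ℤ) ≤ x 0 ^ 2 + x 1 ^ 2 := by
    by_contra! h
    have h0 : x 0 = 0 := by nlinarith [sq_nonneg (x 0), sq_nonneg (x 1)]
    have h1 : x 1 = 0 := by nlinarith [sq_nonneg (x 0), sq_nonneg (x 1)]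
    exact hx (by ext i; fin_cases i <;> simp [h0, h1])
  unfold normSqInt
  exact_mod_cast this

theorem norm_latticeToEuclidean_sq (x : Fin 2 → ℤ) :
    ‖latticeToEuclidean x‖ ^ 2 = normSqInt x := by
  simp [latticeToEuclidean, EuclideanSpace.norm_sq_eq, normSqInt]

open Classical in
/-- A function on `ℤ²` of logarithmic growth, which is superharmonic outside the origin. -/
noncomputable def logPotential (x : Fin 2 → ℤ) : ℝ :=
  if x = 0 then 0 else Real.log (normSqInt x - 1 / 2) + 10

theorem logPotential_of_ne {x : Fin 2 → ℤ} (hx : x ≠ 0) :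
    logPotential x = Real.log (normSqInt x - 1 / 2) + 10 := if_neg hx

theorem logPotential_nonneg (x : Fin 2 → ℤ) : 0 ≤ logPotential x := by
  unfold logPotential
  split_ifs with hx
  · rfl
  · have h1 := one_le_normSqInt hx
    have h2 := Real.one_sub_inv_le_log_of_pos (by linarith : 0 < normSqInt x - 1 / 2)
    have h3 : (normSqInt x - 1 / 2)⁻¹ ≤ 2 := by
      rw [inv_le_comm₀ (by linarith) (by norm_num)]; linarith
    linarith

theorem logPotential_le (x : Fin 2 → ℤ) {M : ℝ} (hM : 1 ≤ M) (h : normSqInt x ≤ M) :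
    logPotential x ≤ Real.log M + 10 := by
  unfold logPotential
  split_ifs with hx
  · have := Real.log_nonneg hM
    linarith
  · have h1 := one_le_normSqInt hx
    gcongr <;> linarith

/-- The shift `1 / 2` makes the logarithm superharmonic by a polynomial identity wherever no
neighbour is the origin. At the four neighbours of the origin, where the value `0` enters the
average, the additive constant `10` compensates. -/
theorem nbrAvg_logPotential_le {x : Fin 2 → ℤ} (hx : x ≠ 0) :
    nbrAvg logPotential x ≤ logPotential x := by
  have key : ∀ a b : ℝ, (((a + 1) ^ 2 + b ^ 2 - 1 / 2) * ((a - 1) ^ 2 + b ^ 2 - 1 / 2) *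
      ((a ^ 2 + (b + 1) ^ 2 - 1 / 2) * (a ^ 2 + (b - 1) ^ 2 - 1 / 2))) ≤
      (a ^ 2 + b ^ 2 - 1 / 2) ^ 4 := by
    intro a b
    -- The right side minus the left side is exactly `4 * (a ^ 2 - b ^ 2) ^ 2`.
    nlinarith [sq_nonneg (a ^ 2 - b ^ 2)]
  have hexp : Real.log 126 ≤ 10 := by
    rw [Real.log_le_iff_le_exp (by norm_num)]
    have h1 := Real.exp_one_gt_d9
    have h2 : Real.exp 10 = Real.exp 1 ^ 10 := by rw [← Real.exp_nat_mul]; norm_num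
    rw [h2]
    calc (126 : ℝ) ≤ 2 ^ 10 := by norm_num
      _ ≤ _ := by gcongr; linarith
  by_cases h1 : normSqInt x = 1
  · have hcases : x = ![1, 0] ∨ x = ![-1, 0] ∨ x = ![0, 1] ∨ x = ![0, -1] := by
      have hi : x 0 ^ 2 + x 1 ^ 2 = 1 := by unfold normSqInt at h1; exact_mod_cast h1
      have ha : x 0 ≤ 1 := by nlinarith
      have hb : -1 ≤ x 0 := by nlinarith
      have hc : x 1 ≤ 1 := by nlinarith
      have hd : -1 ≤ x 1 := by nlinarith
      have hxe : x = ![x 0, x 1] := by ext i; fin_cases i <;> rfl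
      generalize x 0 = u at *
      generalize x 1 = v at *
      subst hxe
      interval_cases u <;> interval_cases v <;> simp_all
    -- The neighbours of a unit vector have squared norms `0, 4, 2, 2`. The claim there reduces to
    -- `log 126 ≤ 10`.
    have e1 : Real.log (7 / 2) + 2 * Real.log (3 / 2) - 4 * Real.log (1 / 2) = Real.log 126 := by
      have h2 := Real.log_pow (3 / 2) 2
      have h3 := Real.log_pow (1 / 2) 4
      push_cast at h2 h3
      rw [← h2, ← h3, ← Real.log_mul (by norm_num) (by norm_num),
        ← Real.log_div (by norm_num) (by norm_num)]
      norm_num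
    rcases hcases with rfl | rfl | rfl | rfl <;>
      · simp [nbrAvg, logPotential, normSqInt]
        norm_num at e1 ⊢
        linarith
  · have h2 : 2 ≤ normSqInt x := by
      have := one_le_normSqInt hx
      unfold normSqInt at *
      have h3 : (1 : ℤ) ≤ x 0 ^ 2 + x 1 ^ 2 := by exact_mod_cast this
      have h4 : x 0 ^ 2 + x 1 ^ 2 ≠ (1 : ℤ) := by exact_mod_cast h1
      exact_mod_cast (by omega : (2 : ℤ) ≤ x 0 ^ 2 + x 1 ^ 2)
    have hne : ∀ e : Fin 2 → ℤ, normSqInt (-e) = 1 → x + e ≠ 0 := by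
      intro e he h0
      rw [eq_neg_of_add_eq_zero_left h0] at h1
      exact h1 he
    have n1 : x + ![1, 0] ≠ 0 := hne _ (by simp [normSqInt])
    have n2 : x + ![-1, 0] ≠ 0 := hne _ (by simp [normSqInt])
    have n3 : x + ![0, 1] ≠ 0 := hne _ (by simp [normSqInt])
    have n4 : x + ![0, -1] ≠ 0 := hne _ (by simp [normSqInt])
    have q1 := one_le_normSqInt n1
    have q2 := one_le_normSqInt n2
    have q3 := one_le_normSqInt n3
    have q4 := one_le_normSqInt n4
    rw [nbrAvg, logPotential_of_ne n1, logPotential_of_ne n2, logPotential_of_ne n3,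
      logPotential_of_ne n4, logPotential_of_ne hx]
    have hlog : Real.log (normSqInt (x + ![1, 0]) - 1 / 2) +
        Real.log (normSqInt (x + ![-1, 0]) - 1 / 2) + (Real.log (normSqInt (x + ![0, 1]) - 1 / 2) +
        Real.log (normSqInt (x + ![0, -1]) - 1 / 2)) ≤ 4 * Real.log (normSqInt x - 1 / 2) := by
      have p1 : 0 < normSqInt (x + ![1, 0]) - 1 / 2 := by linarith
      have p2 : 0 < normSqInt (x + ![-1, 0]) - 1 / 2 := by linarith
      have p3 : 0 < normSqInt (x + ![0, 1]) - 1 / 2 := by linarith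
      have p4 : 0 < normSqInt (x + ![0, -1]) - 1 / 2 := by linarith
      rw [← Real.log_mul p1.ne' p2.ne', ← Real.log_mul p3.ne' p4.ne',
        ← Real.log_mul (by positivity) (by positivity),
        show (4 : ℝ) = ((4 : ℕ) : ℝ) by norm_num, ← Real.log_pow]
      refine Real.log_le_log (by positivity) ?_
      have := key (x 0) (x 1)
      simpa [normSqInt, sub_eq_add_neg] using this
    linarith

/-- The first loss bounds the probability of leaving the disc `normSqInt ≤ Q` before reaching the
origin, by optional stopping for `logPotential`. The second bounds the probability of doing neither
by time `k`, by Markov's inequality and the drift `1` of the squared norm. Instead of stopping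
times, induction on `k` shows that the left side is a subsolution of the recursion for `srwHit`. The
room between `Q` and `D` keeps the neighbours of points of the disc in range. -/
theorem one_sub_le_srwHit {Q D : ℝ} (hQ : 1 ≤ Q) (hD : 2 * Q + 2 ≤ D) (k : ℕ) (x : Fin 2 → ℤ)
    (hx : normSqInt x ≤ D) :
    1 - logPotential x / (Real.log (Q - 1 / 2) + 10) - (D + 1 - normSqInt x) / (k + 1) ≤
      srwHit k x := by
  set H := Real.log (Q - 1 / 2) + 10 with hH
  have hHpos : 0 < H := by
    have h2 := Real.one_sub_inv_le_log_of_pos (by linarith : 0 < Q - 1 / 2)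
    have h3 : (Q - 1 / 2)⁻¹ ≤ 2 := by
      rw [inv_le_comm₀ (by linarith) (by norm_num)]; linarith
    linarith
  have hnn : ∀ x, 0 ≤ logPotential x / H := fun x => div_nonneg (logPotential_nonneg x) hHpos.le
  induction k generalizing x with
  | zero =>
    have := hnn x
    have := srwHit_nonneg 0 x
    simp only [Nat.cast_zero, zero_add, div_one]
    linarith
  | succ k ih =>
    have hk : (0 : ℝ) < k + 1 := by positivity
    rcases eq_or_ne x 0 with rfl | hx0
    · rw [srwHit_zero_right]
      have := hnn 0
      have : 0 ≤ (D + 1 - normSqInt 0) / ((k + 1 : ℕ) + 1) := by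
        apply div_nonneg <;> [linarith; positivity]
      linarith
    have hsn := srwHit_nonneg (k + 1) x
    -- Outside the disc, or when the time term is at least `1`, the left side is nonpositive. Only
    -- the remaining case needs the recursion.
    rcases lt_or_ge Q (normSqInt x) with hQx | hQx
    · have h1 : 1 ≤ logPotential x / H := by
        rw [one_le_div hHpos, hH, logPotential_of_ne hx0]
        gcongr
        linarith
      have : 0 ≤ (D + 1 - normSqInt x) / ((k + 1 : ℕ) + 1) := by
        apply div_nonneg <;> [linarith; positivity]
      linarith
    rcases lt_or_ge ((k : ℝ) + 2) (D + 1 - normSqInt x) with hl | hl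
    · have h1 : 1 ≤ (D + 1 - normSqInt x) / ((k + 1 : ℕ) + 1) := by
        rw [one_le_div (by positivity)]
        push_cast
        linarith
      have := hnn x
      linarith
    rw [srwHit_succ k hx0]
    have hnorm : normSqInt x = (x 0 : ℝ) ^ 2 + (x 1 : ℝ) ^ 2 := rfl
    have m1 : normSqInt (x + ![1, 0]) = normSqInt x + 2 * x 0 + 1 := by
      simp [normSqInt]; ring
    have m2 : normSqInt (x + ![-1, 0]) = normSqInt x - 2 * x 0 + 1 := by
      simp [normSqInt]; ring
    have m3 : normSqInt (x + ![0, 1]) = normSqInt x + 2 * x 1 + 1 := by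
      simp [normSqInt]; ring
    have m4 : normSqInt (x + ![0, -1]) = normSqInt x - 2 * x 1 + 1 := by
      simp [normSqInt]; ring
    have i1 := ih (x + ![1, 0]) (by nlinarith [sq_nonneg ((x 0 : ℝ) - 1), sq_nonneg (x 1 : ℝ)])
    have i2 := ih (x + ![-1, 0]) (by nlinarith [sq_nonneg ((x 0 : ℝ) + 1), sq_nonneg (x 1 : ℝ)])
    have i3 := ih (x + ![0, 1]) (by nlinarith [sq_nonneg ((x 1 : ℝ) - 1), sq_nonneg (x 0 : ℝ)])
    have i4 := ih (x + ![0, -1]) (by nlinarith [sq_nonneg ((x 1 : ℝ) + 1), sq_nonneg (x 0 : ℝ)])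
    have hsup : nbrAvg logPotential x / H ≤ logPotential x / H :=
      div_le_div_of_nonneg_right (nbrAvg_logPotential_le hx0) hHpos.le
    -- With `u = D + 1 - normSqInt x`, this is equivalent to `u ≤ k + 2`, the case at hand. The `-
    -- 1` is the mean increase of the squared norm in one step.
    have htime : (D + 1 - normSqInt x - 1) / (k + 1) ≤
        (D + 1 - normSqInt x) / ((k + 1 : ℕ) + 1) := by
      rw [div_le_div_iff₀ hk (by positivity)]
      push_cast
      nlinarith
    rw [m1] at i1
    rw [m2] at i2
    rw [m3] at i3
    rw [m4] at i4
    unfold nbrAvg at hsup ⊢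
    have hsplit : (logPotential (x + ![1, 0]) + logPotential (x + ![-1, 0]) +
        logPotential (x + ![0, 1]) + logPotential (x + ![0, -1])) / 4 / H =
        (logPotential (x + ![1, 0]) / H + logPotential (x + ![-1, 0]) / H +
        logPotential (x + ![0, 1]) / H + logPotential (x + ![0, -1]) / H) / 4 := by ring
    have htsplit : (D + 1 - (normSqInt x + 2 * x 0 + 1)) / (k + 1) +
        (D + 1 - (normSqInt x - 2 * x 0 + 1)) / (k + 1) +
        (D + 1 - (normSqInt x + 2 * x 1 + 1)) / (k + 1) +
        (D + 1 - (normSqInt x - 2 * x 1 + 1)) / (k + 1) =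
        4 * ((D + 1 - normSqInt x - 1) / (k + 1)) := by ring
    linarith

/-! ### Compact sets for the Skorokhod topologies -/

namespace SkorokhodSpace

section Compactness

variable {E : Type*} [NormedAddCommGroup E]

/-- Baire category: right-continuity makes the open set of points with local oscillation below `1 /
(n + 1)` dense, and `x` is continuous on the intersection of these sets. -/
theorem exists_continuousAt_gt (x : SkorokhodSpace E) (a : ℝ≥0) : ∃ T, a < T ∧ ContinuousAt x T := by
  let U : ℕ → Set ℝ≥0 := fun n =>
    ⋃₀ {V | IsOpen V ∧ ∀ s ∈ V, ∀ t ∈ V, dist (x s) (x t) < 1 / (n + 1)}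
  have hopen : ∀ n, IsOpen (U n) := fun n => isOpen_sUnion fun V hV => hV.1
  have hdense : ∀ n, Dense (U n) := by
    intro n
    rw [dense_iff_inter_open]
    rintro W hW ⟨t, ht⟩
    have hpos : (0 : ℝ) < 1 / (n + 1) / 2 := by positivity
    have h1 : ∀ᶠ s in 𝓝[>] t, s ∈ W ∧ dist (x s) (x t) < 1 / (n + 1) / 2 :=
      Filter.Eventually.and (mem_nhdsWithin_of_mem_nhds (hW.mem_nhds ht))
        (((x.right_continuous t).mono Ioi_subset_Ici_self).eventually (Metric.ball_mem_nhds _ hpos))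
    obtain ⟨b, hb, hsub⟩ := (mem_nhdsGT_iff_exists_Ioo_subset).1 h1
    obtain ⟨c, hc⟩ := exists_between (mem_Ioi.1 hb)
    refine ⟨c, (hsub hc).1, Ioo t b, ⟨isOpen_Ioo, fun s hs r hr => ?_⟩, hc⟩
    have := dist_triangle_right (x s) (x r) (x t)
    linarith [(hsub hs).2, (hsub hr).2]
  obtain ⟨T, hT, hTU⟩ := (dense_iInter_of_isOpen hopen hdense).inter_open_nonempty (Ioi a)
    isOpen_Ioi ⟨a + 1, by simp⟩
  refine ⟨T, hT, Metric.continuousAt_iff'.2 fun ε hε => ?_⟩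
  obtain ⟨n, hn⟩ := exists_nat_one_div_lt hε
  obtain ⟨V, ⟨hV, hVd⟩, hTV⟩ := mem_iInter.1 hTU n
  filter_upwards [hV.mem_nhds hTV] with s hs using (hVd s hs T hTV).trans hn

theorem exists_norm_le (x : SkorokhodSpace E) (T : ℝ≥0) : ∃ M, ∀ t ≤ T, ‖x t‖ ≤ M := by
  have : ∃ M, ∀ t ∈ Icc 0 T, ‖x t‖ ≤ M := by
    refine isCompact_Icc.induction_on (p := fun s => ∃ M, ∀ t ∈ s, ‖x t‖ ≤ M) ⟨0, by simp⟩
      (fun s t hst ⟨M, hM⟩ => ⟨M, fun r hr => hM r (hst hr)⟩) ?_ ?_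
    · rintro s t ⟨M, hM⟩ ⟨M', hM'⟩
      refine ⟨max M M', fun r hr => ?_⟩
      rcases hr with hr | hr
      · exact (hM r hr).trans (le_max_left _ _)
      · exact (hM' r hr).trans (le_max_right _ _)
    · intro t _
      obtain ⟨l, hl⟩ := x.left_limits t
      have h1 : ∀ᶠ s in 𝓝[<] t, ‖x s‖ < ‖l‖ + 1 := hl.norm.eventually_lt_const (by linarith)
      have h2 : ∀ᶠ s in 𝓝[≥] t, ‖x s‖ < ‖x t‖ + 1 :=
        (x.right_continuous t).norm.eventually_lt_const (by linarith)
      have h3 : ∀ᶠ s in 𝓝 t, ‖x s‖ ≤ max (‖l‖ + 1) (‖x t‖ + 1) := by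
        rw [← nhdsLT_sup_nhdsGE t, eventually_sup]
        exact ⟨h1.mono fun s hs => hs.le.trans (le_max_left _ _),
          h2.mono fun s hs => hs.le.trans (le_max_right _ _)⟩
      exact ⟨_, mem_nhdsWithin_of_mem_nhds h3, _, fun s hs => hs⟩
  obtain ⟨M, hM⟩ := this
  exact ⟨M, fun t ht => hM t ⟨zero_le, ht⟩⟩

theorem norm_leftLim_le (x : SkorokhodSpace E) {t : ℝ≥0} {M : ℝ} (h : ∀ s ≤ t, ‖x s‖ ≤ M) :
    ‖Function.leftLim x t‖ ≤ M := by
  rcases eq_or_neBot (𝓝[<] t) with hb | hb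
  · rw [leftLim_eq_of_eq_bot _ hb]
    exact h t le_rfl
  · obtain ⟨l, hl⟩ := x.left_limits t
    rw [leftLim_eq_of_tendsto hl]
    exact le_of_tendsto hl.norm (eventually_mem_nhdsWithin.mono fun s hs => h s (le_of_lt hs))

variable [NormedSpace ℝ E]

/-- A closeness relation for which the values of `y` are close to points of the completed graph of
`x` at nearby times. -/
def NearGraph (near : ℝ≥0 → ℝ → SkorokhodSpace E → SkorokhodSpace E → Prop) : Prop :=
  ∀ T ε y x, near T ε y x → ∀ s ≤ T, ∃ q ∈ completedGraph x T, dist (y s, s) q < ε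

theorem mem_completedGraph (x : SkorokhodSpace E) {t T : ℝ≥0} (h : t ≤ T) :
    (x t, t) ∈ completedGraph x T := ⟨h, right_mem_segment ℝ _ _⟩

theorem nearGraph_nearJ2 : NearGraph (NearJ2 (E := E)) := by
  rintro T ε y x ⟨l, hl⟩ s hs
  obtain ⟨t, ht⟩ := l.surjective ⟨s, zero_le, hs⟩
  refine ⟨(x t, t), mem_completedGraph x t.2.2, ?_⟩
  have := hl t
  rw [ht] at this
  rw [Prod.dist_eq, max_lt_iff]
  exact ⟨this.2, this.1⟩

theorem nearGraph_nearJ1 : NearGraph (NearJ1 (E := E)) := by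
  rintro T ε y x ⟨l, hl⟩
  exact nearGraph_nearJ2 T ε y x ⟨l.toEquiv, hl⟩

theorem nearGraph_nearM1 : NearGraph (NearM1 (E := E)) := by
  rintro T ε y x ⟨p, q, hp, hq, hpq⟩ s hs
  have h := mem_completedGraph y hs
  rw [← hp.2.1] at h
  obtain ⟨r, hr⟩ := h
  exact ⟨q r, hq.2.1 ▸ mem_range_self r, hr ▸ hpq r⟩

theorem nearGraph_nearM2 : NearGraph (NearM2 (E := E)) := by
  intro T ε y x h s hs
  obtain ⟨q, hq, hd⟩ := Metric.exists_edist_lt_of_hausdorffEDist_lt (mem_completedGraph y hs) h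
  refine ⟨q, hq, ?_⟩
  rw [edist_dist] at hd
  exact (ENNReal.ofReal_lt_ofReal_iff_of_nonneg dist_nonneg).1 hd

/-- A nearby path takes values close to the completed graph at slightly displaced times.
Right-continuity extends the bound on `x` a little beyond `T`, and convexity of balls extends it to
the jump segments. -/
theorem isOpen_setOf_norm_lt {near : ℝ≥0 → ℝ → SkorokhodSpace E → SkorokhodSpace E → Prop}
    (hnear : NearGraph near) (T : ℝ≥0) (M : ℝ) :
    IsOpen[topologyOfNear near] {x | ∃ M' < M, ∀ t ≤ T, ‖x t‖ ≤ M'} := by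
  -- For `TopologicalSpace.mkOfNhds`, a set is open when it belongs to the prescribed filter at each
  -- of its points. No neighbourhood axioms are needed for this.
  intro x hx
  obtain ⟨M', hM', hx⟩ := hx
  obtain ⟨M₁, h1, h1'⟩ := exists_between hM'
  obtain ⟨M₂, h2, h2'⟩ := exists_between h1'
  have hr : ∀ᶠ s in 𝓝[≥] T, ‖x s‖ < M₁ :=
    (x.right_continuous T).norm.eventually_lt_const ((hx T le_rfl).trans_lt h1)
  obtain ⟨b, hb, hsub⟩ := (mem_nhdsGE_iff_exists_Ico_subset).1 hr
  have hxb : ∀ s < b, ‖x s‖ ≤ M₁ := fun s hs => by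
    rcases le_total s T with h | h
    · exact (hx s h).trans h1.le
    · exact le_of_lt (hsub ⟨h, hs⟩)
  obtain ⟨T', hT', hcont⟩ := exists_continuousAt_gt x T
  have hb' : (0 : ℝ) < b - T := sub_pos.2 (by exact_mod_cast hb)
  have hε : 0 < min (M₂ - M₁) (b - T : ℝ) := lt_min (sub_pos.2 h2) hb'
  refine mem_iInf_of_mem T' (mem_iInf_of_mem ⟨pos_of_gt hT', hcont⟩
    (mem_iInf_of_mem _ (mem_iInf_of_mem hε (mem_principal.2 ?_))))
  intro y hy
  refine ⟨M₂, h2', fun s hs => ?_⟩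
  obtain ⟨⟨z, t⟩, ⟨-, hz⟩, hd⟩ := hnear _ _ _ _ hy s (hs.trans hT'.le)
  rw [Prod.dist_eq, max_lt_iff] at hd
  have ht : t < b := by
    have h3 : dist s t < b - T := hd.2.trans_le (min_le_right _ _)
    rw [NNReal.dist_eq, abs_lt] at h3
    have h4 : (s : ℝ) ≤ T := by exact_mod_cast hs
    have : (t : ℝ) < b := by linarith
    exact_mod_cast this
  have hzn : ‖z‖ ≤ M₁ := by
    have hball := (convex_closedBall (0 : E) M₁).segment_subset
      (mem_closedBall_zero_iff.2 (norm_leftLim_le x fun s hs => hxb s (hs.trans_lt ht)))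
      (mem_closedBall_zero_iff.2 (hxb t ht))
    exact mem_closedBall_zero_iff.1 (hball hz)
  have h5 : dist (y s) z < M₂ - M₁ := hd.1.trans_le (min_le_left _ _)
  rw [dist_eq_norm] at h5
  have := norm_le_norm_add_norm_sub' (y s) z
  linarith

theorem exists_norm_lt_of_isCompact
    {near : ℝ≥0 → ℝ → SkorokhodSpace E → SkorokhodSpace E → Prop}
    (hnear : NearGraph near) {K : Set (SkorokhodSpace E)}
    (hK : @IsCompact _ (topologyOfNear near) K) (T : ℝ≥0) :
    ∃ M : ℝ, ∀ x ∈ K, ∀ t ≤ T, ‖x t‖ < M := by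
  let := topologyOfNear near
  obtain ⟨n, hn⟩ := hK.elim_directed_cover
    (fun n : ℕ => {x : SkorokhodSpace E | ∃ M' < (n : ℝ), ∀ t ≤ T, ‖x t‖ ≤ M'})
    (fun n => isOpen_setOf_norm_lt hnear T n)
    (fun x _ => by
      obtain ⟨M, hM⟩ := exists_norm_le x T
      obtain ⟨n, hn⟩ := exists_nat_gt M
      exact mem_iUnion.2 ⟨n, M, hn, hM⟩)
    (Monotone.directed_le fun m n hmn x ⟨M', h, hM'⟩ =>
      ⟨M', h.trans_le (by exact_mod_cast hmn), hM'⟩)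
  refine ⟨n, fun x hx t ht => ?_⟩
  obtain ⟨M', h, hM'⟩ := hn hx
  exact (hM' t ht).trans_lt h

/-- A family of laws of rescaled random sequences is not tight if the maxima over growing time
windows escape to infinity with probability bounded away from zero. -/
theorem not_isTightMeasureSet_scaledPath [MeasurableSpace E] [BorelSpace E]
    [SecondCountableTopology E]
    {near : ℝ≥0 → ℝ → SkorokhodSpace E → SkorokhodSpace E → Prop} (hnear : NearGraph near)
    {Ω : Type*} [MeasurableSpace Ω] {P : Measure Ω} {Y : ℕ → Ω → E} (hY : ∀ n, Measurable (Y n))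
    {c : ℕ → ℝ} (hc : ∀ n, 1 ≤ n → 0 < c n) {δ : ℝ≥0∞} (hδ : 0 < δ)
    (h : ∀ M : ℝ, ∃ n, 1 ≤ n ∧ δ ≤ P {ω | ∃ k ≤ n, M * c n ≤ ‖Y k ω‖}) :
    ¬ @IsTightMeasureSet (SkorokhodSpace E) _ (topologyOfNear near)
      {ν | ∃ n : ℕ, 1 ≤ n ∧ ν = P.map fun ω => scaledPath (fun k => Y k ω) n (c n)} := by
  intro htight
  let := topologyOfNear near
  obtain ⟨ε, hε0, hε⟩ := exists_between hδ
  obtain ⟨K, hK, hKε⟩ := isTightMeasureSet_iff_exists_isCompact_measure_compl_le.1 htight ε hε0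
  obtain ⟨M, hM⟩ := exists_norm_lt_of_isCompact hnear hK 1
  obtain ⟨n, hn, hPn⟩ := h M
  have hmeas : Measurable fun ω => scaledPath (fun k => Y k ω) n (c n) := by
    refine measurable_comap_iff.2 (measurable_pi_iff.2 fun t => ?_)
    exact (hY _).const_smul _
  -- `K` need not be measurable for the evaluation `σ`-algebra. The inequality for image measures
  -- holds for every set.
  have h1 := (Measure.le_map_apply hmeas.aemeasurable Kᶜ).trans (hKε _ ⟨n, hn, rfl⟩)
  refine absurd (hPn.trans ((measure_mono ?_).trans h1)) (not_le.2 hε)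
  rintro ω ⟨k, hk, hkM⟩ hω
  have hn' : (n : ℝ≥0) ≠ 0 := by exact_mod_cast (by omega : n ≠ 0)
  have h2 := hM _ hω (k / n : ℝ≥0) (div_le_one_of_le₀ (by exact_mod_cast hk) zero_le)
  have h3 : scaledPath (fun k => Y k ω) n (c n) (k / n : ℝ≥0) = (c n)⁻¹ • Y k ω := by
    change (c n)⁻¹ • Y ⌊(n : ℝ≥0) * (k / n)⌋₊ ω = _
    rw [mul_div_cancel₀ _ hn', Nat.floor_natCast]
  have hcn := hc n hn
  rw [h3, norm_smul, Real.norm_of_nonneg (inv_nonneg.2 hcn.le), inv_mul_lt_iff₀ hcn] at h2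
  linarith

end Compactness

end SkorokhodSpace

/-! ### Large values of the perturbed walk -/

/-- One excursion: either the jump lands in `B`, or it lands in `G`, the walk returns within `s`
steps, and `j` further steps remain. -/
theorem le_hitProb_origin (η : (Fin 2 → ℤ) → PMF (Fin 2 → ℤ)) {B G : Set (Fin 2 → ℤ)}
    (hBG : Disjoint B G) {s : ℕ} {c : ℝ} (hG : ∀ y ∈ G, c ≤ srwHit s y) (j : ℕ) :
    (η 0).toOuterMeasure B + (η 0).toOuterMeasure G * ENNReal.ofReal c *
        hitProb (perturbedTransition {0} simpleStep η) B j 0 ≤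
      hitProb (perturbedTransition {0} simpleStep η) B (j + s + 1) 0 := by
  rw [hitProb, PMF.toOuterMeasure_apply, PMF.toOuterMeasure_apply, mul_assoc,
    ← ENNReal.tsum_mul_right, ← ENNReal.tsum_add]
  refine ENNReal.tsum_le_tsum fun y => ?_
  rw [perturbedTransition_zero]
  by_cases hyB : y ∈ B
  · have hyG : y ∉ G := disjoint_left.1 hBG hyB
    simp [hyB, hyG]
  · by_cases hyG : y ∈ G
    · have := (mul_le_mul_left (ENNReal.ofReal_le_ofReal (hG y hyG)) _).trans
        (srwHit_mul_hitProb_le η B j s y)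
      simp only [hyB, hyG, indicator_of_mem, indicator_of_notMem, not_false_eq_true, zero_add,
        mem_compl_iff]
      gcongr
    · simp [hyB, hyG]

/-- Iterating `h ↦ b + ρ * h` gives a geometric sum. As `ρ ≤ 1`, each of its `m` terms is at least
`b * ρ ^ m`. -/
theorem le_hitProb_origin_iterate (η : (Fin 2 → ℤ) → PMF (Fin 2 → ℤ)) {B G : Set (Fin 2 → ℤ)}
    (hBG : Disjoint B G) {s : ℕ} {c : ℝ} (hc : c ≤ 1) (hG : ∀ y ∈ G, c ≤ srwHit s y) (m : ℕ) :
    m * (η 0).toOuterMeasure B * ((η 0).toOuterMeasure G * ENNReal.ofReal c) ^ m ≤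
      hitProb (perturbedTransition {0} simpleStep η) B (m * (s + 1)) 0 := by
  have hw : (η 0).toOuterMeasure G ≤ 1 := by
    rw [PMF.toOuterMeasure_apply, ← (η 0).tsum_coe]
    exact ENNReal.tsum_le_tsum fun y => indicator_le_self _ _ _
  set b := (η 0).toOuterMeasure B
  set ρ := (η 0).toOuterMeasure G * ENNReal.ofReal c with hρ
  have hρ1 : ρ ≤ 1 := mul_le_one' hw (by simpa using hc)
  induction m with
  | zero => simp
  | succ m ih =>
    have h1 := le_hitProb_origin η hBG hG (m * (s + 1))
    rw [show (m + 1) * (s + 1) = m * (s + 1) + s + 1 by ring]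
    refine le_trans ?_ h1
    calc ((m + 1 : ℕ) : ℝ≥0∞) * b * ρ ^ (m + 1)
        = b * ρ ^ (m + 1) + ρ * (m * b * ρ ^ m) := by push_cast; ring
      _ ≤ b * 1 + ρ * hitProb (perturbedTransition {0} simpleStep η) B (m * (s + 1)) 0 := by
          gcongr
          exact pow_le_one' hρ1 _
      _ = _ := by rw [mul_one]

/-- From points that are not too far away, the simple random walk returns quickly. -/
theorem one_sub_le_srwHit_of_norm_le {v : ℝ} (hv : 8 ≤ v) {s : ℕ}
    (hs : Real.exp (v ^ 2 / 2) ≤ s + 1) {y : Fin 2 → ℤ}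
    (hy : ‖latticeToEuclidean y‖ ≤ Real.exp v) : 1 - 16 / v ≤ srwHit s y := by
  have hvp : 0 < v := by linarith
  -- The disc has squared radius `Q`, the square root of the lower bound for `s + 1`, so both losses
  -- are small. The condition `8 ≤ v` puts `y` inside the disc.
  set Q := Real.exp (v ^ 2 / 4) with hQdef
  have hQv : v ^ 2 / 4 ≤ Q := by linarith [Real.add_one_le_exp (v ^ 2 / 4)]
  have hQ1 : 16 ≤ Q := by nlinarith
  have hyn : normSqInt y ≤ Real.exp (2 * v) := by
    rw [← norm_latticeToEuclidean_sq, two_mul, Real.exp_add, sq]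
    gcongr
  have hyQ : Real.exp (2 * v) ≤ Q := Real.exp_le_exp.2 (by nlinarith)
  have hmain := one_sub_le_srwHit (Q := Q) (D := 2 * Q + 2) (by linarith) le_rfl s y
    (by linarith)
  have h1 : logPotential y ≤ 2 * v + 10 := by
    have := logPotential_le y (Real.one_le_exp (by linarith : 0 ≤ 2 * v)) hyn
    rwa [Real.log_exp] at this
  have h2 : v ^ 2 / 4 ≤ Real.log (Q - 1 / 2) + 10 := by
    have h3 : Real.log (Q / 2) ≤ Real.log (Q - 1 / 2) :=
      Real.log_le_log (by linarith) (by linarith)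
    rw [Real.log_div (by positivity) (by norm_num), Real.log_exp] at h3
    have := Real.log_two_lt_d9
    linarith
  have h4 : logPotential y / (Real.log (Q - 1 / 2) + 10) ≤ (2 * v + 10) / (v ^ 2 / 4) :=
    div_le_div₀ (by positivity) h1 (by positivity) h2
  have h5 : (2 * Q + 2 + 1 - normSqInt y) / (s + 1) ≤ 20 / v ^ 2 := by
    have hn0 : 0 ≤ normSqInt y := by unfold normSqInt; positivity
    have hQQ : Q * Q ≤ s + 1 := by
      rw [hQdef, ← Real.exp_add]
      convert hs using 2
      ring
    rw [div_le_div_iff₀ (by positivity) (by positivity)]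
    calc (2 * Q + 2 + 1 - normSqInt y) * v ^ 2 ≤ (5 * Q) * (4 * Q) := by
          gcongr <;> linarith
      _ ≤ 20 * (s + 1) := by linarith
  have h6 : (2 * v + 10) / (v ^ 2 / 4) + 20 / v ^ 2 ≤ 16 / v := by
    rw [show (2 * v + 10) / (v ^ 2 / 4) + 20 / v ^ 2 = (8 * v + 60) / v ^ 2 by field_simp; ring,
      div_le_div_iff₀ (by positivity) hvp]
    nlinarith
  linarith

section

variable {Ω : Type*} [MeasurableSpace Ω] {P : Measure Ω} [IsProbabilityMeasure P]
  {η : (Fin 2 → ℤ) → PMF (Fin 2 → ℤ)} {X : ℕ → Ω → (Fin 2 → ℤ)}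

theorem measure_preimage_one_eq (hX : IsMarkovChain (perturbedTransition {0} simpleStep η) X P)
    (hX0 : ∀ᵐ ω ∂P, X 0 ω = 0) (A : Set (Fin 2 → ℤ)) :
    P (X 1 ⁻¹' A) = (η 0).toOuterMeasure A := by
  have hsing : ∀ y, P (X 1 ⁻¹' {y}) = η 0 y := by
    intro y
    have h := hX.2 0 (fun k => if k = 0 then 0 else y)
    have h1 : P {ω | ∀ k ≤ 0, X k ω = if k = 0 then 0 else y} = 1 := by
      rw [← measure_univ (μ := P)]
      refine measure_congr ?_
      filter_upwards [hX0] with ω hω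
      apply propext
      change (∀ k ≤ 0, X k ω = if k = 0 then 0 else y) ↔ True
      simp [hω]
    have h2 : P {ω | ∀ k ≤ 0 + 1, X k ω = if k = 0 then 0 else y} = P (X 1 ⁻¹' {y}) := by
      refine measure_congr ?_
      filter_upwards [hX0] with ω hω
      apply propext
      change (∀ k ≤ 1, X k ω = if k = 0 then 0 else y) ↔ X 1 ω = y
      refine ⟨fun h => by simpa using h 1 le_rfl, fun h k hk => ?_⟩
      interval_cases k <;> simp [hω, h]
    rw [h1, h2, one_mul] at h
    simpa [perturbedTransition_zero] using h
  have hA : MeasurableSet A := A.to_countable.measurableSet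
  rw [← Measure.map_apply (hX.1 1) hA, ← Measure.tsum_indicator_apply_singleton _ A hA,
    PMF.toOuterMeasure_apply]
  refine tsum_congr fun y => ?_
  congr 1
  ext y
  rw [Measure.map_apply (hX.1 1) (measurableSet_singleton y), hsing]

theorem hitProb_origin_le_measure
    (hX : IsMarkovChain (perturbedTransition {0} simpleStep η) X P)
    (hX0 : ∀ᵐ ω ∂P, X 0 ω = 0) (B : Set (Fin 2 → ℤ)) (n : ℕ) :
    hitProb (perturbedTransition {0} simpleStep η) B n 0 ≤
      P {ω | ∃ k ∈ Finset.Icc 1 n, X k ω ∈ B} := by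
  have h := hitProb_le_measure hX B.to_countable.measurableSet n 0 0
  have h1 : P {ω | ∀ i ≤ 0, X i ω = (0 : ℕ → Fin 2 → ℤ) i} = 1 := by
    rw [← measure_univ (μ := P)]
    refine measure_congr ?_
    filter_upwards [hX0] with ω hω
    apply propext
    change (∀ k ≤ 0, X k ω = 0) ↔ True
    simp [hω]
  rw [h1, one_mul] at h
  refine h.trans (measure_mono fun ω hω => ?_)
  simpa using hω.2

/-- Each excursion fails to be a short jump with quick return with probability at most `δ + t`,
where `t` is the tail at `r`. Bernoulli's inequality makes the loss over `m` excursions linear. -/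
theorem le_measure_exists_lt_norm
    (hX : IsMarkovChain (perturbedTransition {0} simpleStep η) X P)
    (hX0 : ∀ᵐ ω ∂P, X 0 ω = 0) {r N δ : ℝ} (hrN : r ≤ N) (hδ : 0 ≤ δ) {s m n : ℕ}
    (hmn : m * (s + 1) ≤ n)
    (hs : ∀ y : Fin 2 → ℤ, ‖latticeToEuclidean y‖ ≤ r → 1 - δ ≤ srwHit s y)
    (hsmall : δ + P.real {ω | r < ‖latticeToEuclidean (X 1 ω)‖} ≤ 1) :
    ENNReal.ofReal (m * P.real {ω | N < ‖latticeToEuclidean (X 1 ω)‖} *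
      (1 - m * (δ + P.real {ω | r < ‖latticeToEuclidean (X 1 ω)‖}))) ≤
      P {ω | ∃ k ∈ Finset.Icc 1 n, N < ‖latticeToEuclidean (X k ω)‖} := by
  set B : Set (Fin 2 → ℤ) := {y | N < ‖latticeToEuclidean y‖}
  set G : Set (Fin 2 → ℤ) := {y | ‖latticeToEuclidean y‖ ≤ r}
  set t := P.real {ω | r < ‖latticeToEuclidean (X 1 ω)‖} with ht
  have hBG : Disjoint B G := disjoint_left.2 fun y hB hG => by
    have h1 : N < ‖latticeToEuclidean y‖ := hB
    have h2 : ‖latticeToEuclidean y‖ ≤ r := hG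
    linarith
  have hwB : (η 0).toOuterMeasure B =
      ENNReal.ofReal (P.real {ω | N < ‖latticeToEuclidean (X 1 ω)‖}) := by
    rw [ofReal_measureReal, ← measure_preimage_one_eq hX hX0]
    rfl
  have hwG : (η 0).toOuterMeasure G = ENNReal.ofReal (1 - t) := by
    have hmeas : MeasurableSet (X 1 ⁻¹' Gᶜ) := hX.1 1 Gᶜ.to_countable.measurableSet
    have : X 1 ⁻¹' Gᶜ = {ω | r < ‖latticeToEuclidean (X 1 ω)‖} := by
      ext ω; simp [G]
    rw [ht, ← this, ← probReal_compl_eq_one_sub hmeas, ofReal_measureReal, ← preimage_compl,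
      compl_compl, measure_preimage_one_eq hX hX0]
  have ht0 : 0 ≤ t := measureReal_nonneg
  refine le_trans ?_ ((le_hitProb_origin_iterate η hBG (by linarith) hs m).trans
    ((hitProb_mono _ B 0 hmn).trans (hitProb_origin_le_measure hX hX0 B n)))
  have hb : 0 ≤ P.real {ω | N < ‖latticeToEuclidean (X 1 ω)‖} := measureReal_nonneg
  rw [hwB, hwG, ← ENNReal.ofReal_mul (by linarith), ← ENNReal.ofReal_pow (by nlinarith),
    ← ENNReal.ofReal_natCast, ← ENNReal.ofReal_mul (by positivity),
    ← ENNReal.ofReal_mul (by positivity)]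
  refine ENNReal.ofReal_le_ofReal ?_
  gcongr
  calc 1 - m * (δ + t) = 1 + m * (-(δ + t)) := by ring
    _ ≤ (1 + -(δ + t)) ^ m := one_add_mul_le_pow (by linarith) m
    _ ≤ ((1 - t) * (1 - δ)) ^ m := by
        gcongr
        · linarith
        · nlinarith

/-- With `L = log log n`, a huge jump has probability at least `a / (4 * L)`, and an excursion is
spoiled with probability at most `5 * a / L`. Taking `m ≈ L / (10 * a)` excursions balances the two:
the bound is `1 / 80` times `1 - 1 / 2`. -/
theorem eventually_le_measure_exists_sq_lt_norm
    (hX : IsMarkovChain (perturbedTransition {0} simpleStep η) X P)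
    (hX0 : ∀ᵐ ω ∂P, X 0 ω = 0) {a : ℝ} (ha : 0 < a)
    (htail : (fun t : ℝ => P.real {ω | t < ‖latticeToEuclidean (X 1 ω)‖})
      ~[atTop] fun t : ℝ => a / Real.log (Real.log t)) :
    ∀ᶠ n : ℕ in atTop, ENNReal.ofReal (1 / 160) ≤
      P {ω | ∃ k ∈ Finset.Icc 1 n, (n : ℝ) ^ 2 < ‖latticeToEuclidean (X k ω)‖} := by
  set T : ℝ → ℝ := fun t => P.real {ω | t < ‖latticeToEuclidean (X 1 ω)‖} with hT
  have hLL : Tendsto (fun t : ℝ => Real.log (Real.log t)) atTop atTop :=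
    Real.tendsto_log_atTop.comp Real.tendsto_log_atTop
  have hbound : ∀ᶠ t in atTop, a / 2 / Real.log (Real.log t) ≤ T t ∧
      T t ≤ 2 * a / Real.log (Real.log t) := by
    have hlo := (IsEquivalent.isLittleO htail).def (by norm_num : (0 : ℝ) < 1 / 2)
    filter_upwards [hlo, hLL.eventually_gt_atTop 0] with t h h0
    simp only [Pi.sub_apply, Real.norm_eq_abs] at h
    rw [abs_of_pos (div_pos ha h0)] at h
    have := abs_le.1 h
    have e1 : a / 2 / Real.log (Real.log t) = a / Real.log (Real.log t) / 2 := by ring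
    have e2 : 2 * a / Real.log (Real.log t) = 2 * (a / Real.log (Real.log t)) := by ring
    have hp := div_pos ha h0
    simp only [hT]
    constructor <;> linarith
  have hlogn : Tendsto (fun n : ℕ => Real.log n) atTop atTop :=
    Real.tendsto_log_atTop.comp tendsto_natCast_atTop_atTop
  have hv : Tendsto (fun n : ℕ => √(Real.log n)) atTop atTop :=
    Real.tendsto_sqrt_atTop.comp hlogn
  have hr := (Real.tendsto_exp_atTop.comp hv).eventually hbound
  have hN := ((tendsto_pow_atTop (α := ℝ) two_ne_zero).comp
    tendsto_natCast_atTop_atTop).eventually hbound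
  have hL : Tendsto (fun n : ℕ => Real.log (Real.log n)) atTop atTop :=
    hLL.comp tendsto_natCast_atTop_atTop
  have hlogv : ∀ᶠ v : ℝ in atTop, Real.log v ≤ a / 32 * v := by
    have h := Real.isLittleO_log_id_atTop.def (by positivity : 0 < a / 32)
    filter_upwards [h, eventually_ge_atTop 0] with v h h0
    simp only [id, Real.norm_eq_abs, abs_of_nonneg h0] at h
    exact (le_abs_self _).trans h
  -- Applied to `l = log n`, this ensures that `m` excursions of length about `√n` fit into time
  -- `n`.
  have hlogl : ∀ᶠ l : ℝ in atTop, Real.log l ≤ 5 * a * (l / 2) := by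
    have h := Real.isLittleO_log_id_atTop.def (by positivity : 0 < 5 * a / 2)
    filter_upwards [h, eventually_ge_atTop 0] with v h h0
    simp only [id, Real.norm_eq_abs, abs_of_nonneg h0] at h
    linarith [(le_abs_self _).trans h]
  filter_upwards [hr, hN, hv.eventually_ge_atTop 8, hL.eventually_ge_atTop (20 * a),
    hL.eventually_ge_atTop 1, hv.eventually hlogv,
    hlogn.eventually hlogl, eventually_ge_atTop 1] with n hr hN hv8 hL20 hL1 hlogv hlogl hn1
  have hn0 : (0 : ℝ) < n := by exact_mod_cast hn1
  set l := Real.log n with hl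
  set v := √l with hvdef
  set L := Real.log l with hLdef
  have hl0 : 0 < l := by
    by_contra! h
    rw [hvdef, Real.sqrt_eq_zero_of_nonpos h] at hv8
    norm_num at hv8
  have hvl : v ^ 2 = l := Real.sq_sqrt hl0.le
  have hv0 : 0 < v := by linarith
  have hlogvL : Real.log v = L / 2 := by
    rw [hLdef, ← hvl, Real.log_pow]; push_cast; ring
  have hL0 : 0 < L := by linarith
  simp only [Function.comp, Real.log_exp] at hr hN
  rw [Real.log_pow, Real.log_mul (by norm_num) hl0.ne', ← hLdef] at hN
  rw [hlogvL] at hr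
  -- The iterated logarithm of `exp v` is `log v = L / 2`, so the tail at the short threshold is
  -- still of order `1 / L`.
  have hTr : T (Real.exp v) ≤ 4 * a / L := hr.2.trans_eq (by field_simp; ring)
  have hTN : a / (4 * L) ≤ T ((n : ℝ) ^ 2) := by
    refine le_trans ?_ hN.1
    have := Real.log_two_lt_d9
    have := Real.log_two_gt_d9
    rw [div_div, Nat.cast_ofNat]
    gcongr a / ?_
    linarith
  have hδ : 16 / v ≤ a / L := by
    rw [div_le_div_iff₀ hv0 hL0]
    linarith
  have hsum : 16 / v + T (Real.exp v) ≤ 5 * a / L := by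
    rw [show 5 * a / L = a / L + 4 * a / L by ring]
    exact add_le_add hδ hTr
  have hexpl : Real.exp l = n := Real.exp_log hn0
  have hexph : Real.exp (l / 2) * Real.exp (l / 2) = n := by
    rw [← Real.exp_add, add_halves, hexpl]
  set m := ⌊L / (10 * a)⌋₊ with hm
  set s := ⌊Real.exp (l / 2)⌋₊ with hs
  have hm1 : (m : ℝ) ≤ L / (10 * a) := Nat.floor_le (by positivity)
  -- Rounding down loses at most `1`, which is at most half of `L / (10 * a)` because `20 * a ≤ L`.
  have hm2 : L / (20 * a) ≤ m := by
    have h1 := Nat.lt_floor_add_one (L / (10 * a))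
    have h2 : L / (10 * a) = 2 * (L / (20 * a)) := by field_simp; ring
    have h3 : 1 ≤ L / (20 * a) := by rw [one_le_div (by positivity)]; exact hL20
    rw [← hm] at h1
    linarith
  have hmn : m * (s + 1) ≤ n := by
    have h1 : (s : ℝ) ≤ Real.exp (l / 2) := Nat.floor_le (Real.exp_pos _).le
    have h2 : 1 ≤ Real.exp (l / 2) := Real.one_le_exp (by positivity)
    have h3 : L / (10 * a) ≤ Real.exp (l / 2) / 2 := by
      rw [div_le_div_iff₀ (by positivity) (by norm_num)]
      have := Real.add_one_le_exp (l / 2)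
      nlinarith
    have h4 : (m : ℝ) * (s + 1) ≤ Real.exp (l / 2) / 2 * (2 * Real.exp (l / 2)) := by
      gcongr <;> linarith
    have h5 : (m : ℝ) * (s + 1) ≤ n := by linarith
    exact_mod_cast h5
  have hmsum : m * (16 / v + T (Real.exp v)) ≤ 1 / 2 := by
    calc m * (16 / v + T (Real.exp v)) ≤ L / (10 * a) * (5 * a / L) := by gcongr
      _ = 1 / 2 := by field_simp; norm_num
  have hmT : 1 / 80 ≤ m * T ((n : ℝ) ^ 2) := by
    calc (1 / 80 : ℝ) = L / (20 * a) * (a / (4 * L)) := by field_simp; norm_num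
      _ ≤ _ := by gcongr
  have hrN : Real.exp v ≤ (n : ℝ) ^ 2 := by
    rw [← hexpl, ← Real.exp_nat_mul, Real.exp_le_exp, ← hvl]
    push_cast
    nlinarith
  refine le_trans (ENNReal.ofReal_le_ofReal ?_) (le_measure_exists_lt_norm hX hX0 hrN
    (by positivity : 0 ≤ 16 / v) hmn (fun y hy => one_sub_le_srwHit_of_norm_le hv8 ?_ hy) ?_)
  · calc (1 / 160 : ℝ) = 1 / 80 * (1 - 1 / 2) := by norm_num
      _ ≤ _ := by
        gcongr
  · rw [hvl]
    exact (Nat.lt_floor_add_one _).le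
  · refine hsum.trans ?_
    rw [div_le_one hL0]
    linarith

end

theorem mainTheorem3 {Ω : Type*} [MeasurableSpace Ω] (P : Measure Ω) [IsProbabilityMeasure P]
    (η : (Fin 2 → ℤ) → PMF (Fin 2 → ℤ)) (X : ℕ → Ω → (Fin 2 → ℤ))
    (hX : IsMarkovChain (perturbedTransition {0} simpleStep η) X P)
    (hX0 : ∀ᵐ ω ∂P, X 0 ω = 0)
    (a : ℝ) (ha : 0 < a)
    (htail : (fun t : ℝ => P.real {ω | t < ‖latticeToEuclidean (X 1 ω)‖})
      ~[atTop] fun t : ℝ => a / Real.log (Real.log t)) :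
    0 < liminf (fun n : ℕ =>
        P {ω | (n : ℝ≥0) < (Finset.Icc 1 n).sup fun k => ‖latticeToEuclidean (X k ω)‖₊}) atTop ∧
    ∀ τ ∈ ({SkorokhodSpace.topologyJ1 (EuclideanSpace ℝ (Fin 2)),
            SkorokhodSpace.topologyJ2 (EuclideanSpace ℝ (Fin 2)),
            SkorokhodSpace.topologyM1 (EuclideanSpace ℝ (Fin 2)),
            SkorokhodSpace.topologyM2 (EuclideanSpace ℝ (Fin 2))} :
            Set (TopologicalSpace (SkorokhodSpace (EuclideanSpace ℝ (Fin 2))))),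
      ¬ @IsTightMeasureSet (SkorokhodSpace (EuclideanSpace ℝ (Fin 2))) _ τ
          {ν | ∃ n : ℕ, 1 ≤ n ∧ ν = P.map fun ω =>
            SkorokhodSpace.scaledPath (fun k => latticeToEuclidean (X k ω)) n n} ∧
      ¬ @IsTightMeasureSet (SkorokhodSpace (EuclideanSpace ℝ (Fin 2))) _ τ
          {ν | ∃ n : ℕ, 1 ≤ n ∧ ν = P.map fun ω =>
            SkorokhodSpace.scaledPath (fun k => latticeToEuclidean (X k ω)) n (Real.sqrt n)} := by
  have hev := eventually_le_measure_exists_sq_lt_norm hX hX0 ha htail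
  have hpos : 0 < ENNReal.ofReal (1 / 160) := ENNReal.ofReal_pos.2 (by norm_num)
  refine ⟨hpos.trans_le (le_liminf_of_le (by isBoundedDefault) ?_), ?_⟩
  · filter_upwards [hev, eventually_ge_atTop 1] with n hn hn1
    refine hn.trans (measure_mono ?_)
    rintro ω ⟨k, hk, hkn⟩
    refine lt_of_lt_of_le ?_ (Finset.le_sup (f := fun k => ‖latticeToEuclidean (X k ω)‖₊) hk)
    have h1 : (1 : ℝ) ≤ n := by exact_mod_cast hn1
    rw [← NNReal.coe_lt_coe, coe_nnnorm, NNReal.coe_natCast]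
    nlinarith
  · have hY : ∀ k, Measurable fun ω => latticeToEuclidean (X k ω) := fun k =>
      (measurable_of_countable latticeToEuclidean).comp (hX.1 k)
    -- The level `n ^ 2` exceeds `M * c n` as soon as `M ≤ n`, so one estimate serves both scalings.
    have hlarge : ∀ c : ℕ → ℝ, (∀ n, 1 ≤ n → 0 < c n ∧ c n ≤ n) → ∀ M : ℝ, ∃ n, 1 ≤ n ∧
        ENNReal.ofReal (1 / 160) ≤
          P {ω | ∃ k ≤ n, M * c n ≤ ‖latticeToEuclidean (X k ω)‖} := by
      intro c hc M
      obtain ⟨n, hn, hn1, hnM⟩ := (hev.and ((eventually_ge_atTop 1).and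
        (tendsto_natCast_atTop_atTop.eventually_ge_atTop M))).exists
      refine ⟨n, hn1, hn.trans (measure_mono ?_)⟩
      rintro ω ⟨k, hk, hkn⟩
      refine ⟨k, (Finset.mem_Icc.1 hk).2, le_trans ?_ hkn.le⟩
      obtain ⟨h1, h2⟩ := hc n hn1
      rw [sq]
      exact mul_le_mul hnM h2 h1.le (Nat.cast_nonneg n)
    have hc1 : ∀ n : ℕ, 1 ≤ n → (0 : ℝ) < n ∧ (n : ℝ) ≤ n := fun n hn =>
      ⟨by exact_mod_cast hn, le_rfl⟩
    have hc2 : ∀ n : ℕ, 1 ≤ n → 0 < √(n : ℝ) ∧ √(n : ℝ) ≤ n := fun n hn => by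
      have h1 : (1 : ℝ) ≤ n := by exact_mod_cast hn
      exact ⟨Real.sqrt_pos.2 (by linarith), Real.sqrt_le_iff.2 ⟨by linarith, by nlinarith⟩⟩
    have hall : ∀ near, SkorokhodSpace.NearGraph (E := EuclideanSpace ℝ (Fin 2)) near → _ ∧ _ :=
      fun near hnear =>
        ⟨SkorokhodSpace.not_isTightMeasureSet_scaledPath hnear (P := P) hY
          (fun n hn => (hc1 n hn).1) hpos (hlarge _ hc1),
        SkorokhodSpace.not_isTightMeasureSet_scaledPath hnear (P := P) hY
          (fun n hn => (hc2 n hn).1) hpos (hlarge _ hc2)⟩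
    rintro τ (rfl | rfl | rfl | rfl)
    · exact hall _ SkorokhodSpace.nearGraph_nearJ1
    · exact hall _ SkorokhodSpace.nearGraph_nearJ2
    · exact hall _ SkorokhodSpace.nearGraph_nearM1
    · exact hall _ SkorokhodSpace.nearGraph_nearM2
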